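/- For $n\ge 0$ and positive integers $s_1,\dots,s_m$, some of which may carry a bar, let \[ \zeta_n(s_1,\dots,s_m)=\sum_{n\ge k_1>k_2>\cdots>k_m\ge 1}\ \prod_{j=1}^m \frac{\varepsilon_j^{k_j}}{k_j^{s_j}}, \] where $\varepsilon_j=-1$ if $s_j$ carries a bar and $\varepsilon_j=1$ otherwise, and let $\zeta(s_1,\dots,s_m)=\lim_{n\to\infty}\zeta_n(s_1,\dots,s_m)$ whenever this limit exists. Write $\{1\}_r$ for the sequence consisting of $r$ (unbarred) ones. Then for every integer $k\ge 1$ the limits defining $\zeta(\bar 1,\{1\}_r,3,\{1\}_{k-1})$ for $0\le r\le k-1$, $\zeta(\bar 3,\{1\}_{k-1})$ and $\zeta(\bar 2,\{1\}_{k-1})$ all exist, and \[ \zeta(\bar 1,\{1\}_{k-1},3,\{1\}_{k-1}) = -\sum_{i=1}^{k-1}\frac{(\ln 2)^i}{i!}\,\zeta(\bar 1,\{1\}_{k-i-1},3,\{1\}_{k-1}) - \frac{(\ln 2)^k}{k!}\,\zeta(\bar 3,\{1\}_{k-1}) + \frac{(-1)^k}{2}\,\zeta(\bar 2,\{1\}_{k-1})^2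 . \] -/

import Mathlib

namespace AltMZV

/-- An argument of a multiple harmonic number: a positive integer `s`, possibly with a bar. -/
structure Arg where
  exponent : ℕ+
  barred : Bool

/-- The argument `s` without a bar. -/
def plain (s : ℕ+) : Arg := ⟨s, false⟩

/-- The argument `s` with a bar. -/
def bar (s : ℕ+) : Arg := ⟨s, true⟩

/-- The factor that an argument contributes at the summation index `k`: it is `1 / k ^ s` for `s`
without a bar, and `(-1) ^ k / k ^ s` for `s` with a bar. -/
noncomputable def Arg.factor (a : Arg) (k : ℕ) : ℝ :=
  (if a.barred then (-1 : ℝ) ^ k else 1) / (k : ℝ) ^ (a.exponent : ℕ)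

open Classical in
/-- The (alternating) multiple harmonic number `ζ_n(s₁, …, s_m)`: the sum over all integers
`n ≥ k₁ > k₂ > ⋯ > k_m ≥ 1` of the product of the factors of `s_j` at `k_j`.
It is `1` for the empty sequence of arguments, and `0` for `n < m`. -/
noncomputable def multipleHarmonic (n : ℕ) (S : List Arg) : ℝ :=
  ∑ k ∈ (Fintype.piFinset fun _ : Fin S.length => Finset.Icc 1 n).filter (fun k => StrictAnti k),
    ∏ j : Fin S.length, (S.get j).factor (k j)

/-- The multiple zeta value with arguments `S` exists: `ζ_n(S)` converges as `n → ∞`. -/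
def Converges (S : List Arg) : Prop :=
  ∃ l : ℝ, Filter.Tendsto (fun n : ℕ => multipleHarmonic n S) Filter.atTop (nhds l)

/-- The (alternating) multiple zeta value `ζ(S) = lim_{n → ∞} ζ_n(S)`
(meaningful when `Converges S`). -/
noncomputable def zeta (S : List Arg) : ℝ :=
  Filter.limUnder Filter.atTop (fun n : ℕ => multipleHarmonic n S)

/-- The sequence `{1}_r` of `r` arguments `1` without a bar. -/
def ones (r : ℕ) : List Arg := List.replicate r (plain 1)

end AltMZV

/-! A leading bar evaluates the multiple polylogarithm `Li_S` at `-1`, so the claim is an identity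
between polylogarithms at `-x`, taken to the limit `x → 1⁻`. Write `1^i` for `i` ones.
Differentiation strips a leading `1` at the cost of a factor `1/(1-X)`, so the derivative of `∑
(-1)^i Li_{1^i} Li_{1^{k+1-i},3,1^k}`, `0 ≤ i ≤ k+1`, telescopes to `(-1)^{k+1} Li_{1^{k+1}}
Li_{3,1^k}'`. Since `X Li_{3,1^k}' = Li_{2,1^k}` and `X Li_{2,1^k}' = Li_{1^{k+1}}`, this is the
derivative of `(-1)^{k+1} Li_{2,1^k}² / 2` (`sum_li_mul_li`). At `-x` the factor `Li_{1^i}` becomes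
`(-log(1+x))^i / i!` (`liNeg_replicate_one`). Abel's limit theorem applies once the series at `-1`
converge, which follows from logarithmic growth of the partial sums of the coefficients
(`sum_liCoeff_le`). -/

open Filter Topology PowerSeries

namespace AltMZV

/-! ### Multiple harmonic numbers as partial sums of Taylor coefficients -/

/-- `ζ_n(s, S) = ∑_{m ≤ n} (factor of s at m) · ζ_{m-1}(S)`. -/
theorem multipleHarmonic_cons (n : ℕ) (a : Arg) (S : List Arg) :
    multipleHarmonic n (a :: S) =
      ∑ m ∈ Finset.Icc 1 n, a.factor m * multipleHarmonic (m - 1) S := by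
  classical
  unfold multipleHarmonic
  simp_rw [Finset.mul_sum]
  rw [Finset.sum_sigma']
  symm
  refine Finset.sum_bij' (fun p _ => (Fin.cons p.1 p.2 : Fin (S.length + 1) → ℕ))
    (fun k _ => ⟨k 0, Fin.tail k⟩) ?_ ?_ ?_ ?_ ?_
  · rintro ⟨m, k⟩ h
    simp only [Finset.mem_sigma, Finset.mem_filter, Fintype.mem_piFinset, Finset.mem_Icc] at h ⊢
    obtain ⟨⟨h1, h2⟩, h3, h4⟩ := h
    refine ⟨fun j => ?_, fun i j hij => ?_⟩
    · refine Fin.cases ?_ (fun j => ?_) j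
      · exact ⟨h1, h2⟩
      · simp only [Fin.cons_succ]
        have := h3 j
        omega
    · induction j using Fin.cases with
      | zero => exact absurd hij (Fin.not_lt_zero i)
      | succ j =>
        induction i using Fin.cases with
        | zero =>
          simp only [Fin.cons_succ, Fin.cons_zero]
          have := h3 j
          omega
        | succ i =>
          simp only [Fin.cons_succ]
          exact h4 (Fin.succ_lt_succ_iff.1 hij)
  · intro k h
    simp only [Finset.mem_sigma, Finset.mem_filter, Fintype.mem_piFinset, Finset.mem_Icc] at h ⊢
    obtain ⟨h3, h4⟩ := h
    refine ⟨h3 0, fun j => ⟨(h3 j.succ).1, ?_⟩, fun i j hij => h4 (Fin.succ_lt_succ_iff.2 hij)⟩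
    have : k j.succ < k 0 := h4 (Fin.succ_pos j)
    simp only [Fin.tail]
    omega
  · rintro ⟨m, k⟩ _
    simp
  · intro k _
    exact Fin.cons_self_tail k
  · rintro ⟨m, k⟩ _
    exact (Fin.prod_univ_succ (n := S.length)
      (fun j => ((a :: S).get j).factor ((Fin.cons m k : Fin (S.length + 1) → ℕ) j))).symm

theorem multipleHarmonic_nil (n : ℕ) : multipleHarmonic n [] = 1 := by
  classical
  unfold multipleHarmonic
  rw [Finset.filter_true_of_mem (fun k _ i => i.elim0)]
  simp

/-- The `n`-th Taylor coefficient of the multiple polylogarithm `Li_S`. -/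
noncomputable def liCoeff : List ℕ+ → ℕ → ℝ
  | [], n => if n = 0 then 1 else 0
  | s :: S, n => (∑ m ∈ Finset.range n, liCoeff S m) / (n : ℝ) ^ (s : ℕ)

theorem multipleHarmonic_map_plain (S : List ℕ+) (n : ℕ) :
    multipleHarmonic n (S.map plain) = ∑ m ∈ Finset.range (n + 1), liCoeff S m := by
  induction S generalizing n with
  | nil => simp [multipleHarmonic_nil, liCoeff]
  | cons s S ih =>
    rw [List.map_cons, multipleHarmonic_cons, Finset.sum_range_eq_add_Ico _ (Nat.succ_pos n)]
    -- Index 0 contributes nothing: its inner sum is empty.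
    simp only [liCoeff, Finset.range_zero, Finset.sum_empty, zero_div, zero_add]
    refine Finset.sum_congr (by ext; simp) fun m hm => ?_
    rw [Finset.mem_Ico] at hm
    rw [ih, Nat.sub_add_cancel hm.1]
    simp [Arg.factor, plain, div_eq_inv_mul]

theorem multipleHarmonic_bar_cons (s : ℕ+) (S : List ℕ+) (n : ℕ) :
    multipleHarmonic n (bar s :: S.map plain) =
      ∑ m ∈ Finset.range (n + 1), (-1 : ℝ) ^ m * liCoeff (s :: S) m := by
  rw [multipleHarmonic_cons, Finset.sum_range_eq_add_Ico _ (Nat.succ_pos n)]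
  simp only [liCoeff, Finset.range_zero, Finset.sum_empty, zero_div, mul_zero, zero_add]
  refine Finset.sum_congr (by ext; simp) fun m hm => ?_
  rw [Finset.mem_Ico] at hm
  rw [multipleHarmonic_map_plain, Nat.sub_add_cancel hm.1]
  simp [Arg.factor, bar]
  ring

/-! ### Formal differential equations and the telescoping identity -/

/-- The multiple polylogarithm `Li_S` as a formal power series. -/
noncomputable def li (S : List ℕ+) : ℝ⟦X⟧ := PowerSeries.mk (liCoeff S)

theorem li_nil : li [] = 1 := by
  ext n
  simp [li, liCoeff, PowerSeries.coeff_one]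

theorem constantCoeff_li_cons (s : ℕ+) (S : List ℕ+) : constantCoeff (li (s :: S)) = 0 := by
  rw [← PowerSeries.coeff_zero_eq_constantCoeff_apply]
  simp [li, liCoeff]

/-- `PowerSeries.mk 1` is `1/(1-X)`; multiplying by it forms partial sums of coefficients. -/
theorem derivative_li_one_cons (S : List ℕ+) :
    d⁄dX ℝ (li (1 :: S)) = li S * PowerSeries.mk 1 := by
  ext n
  rw [PowerSeries.coeff_derivative, PowerSeries.coeff_mul,
    Finset.Nat.sum_antidiagonal_eq_sum_range_succ_mk]
  have : (n : ℝ) + 1 ≠ 0 := by positivity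
  simp [li, liCoeff]
  field_simp

theorem X_mul_derivative_li_cons (s : ℕ+) (S : List ℕ+) :
    X * d⁄dX ℝ (li ((s + 1) :: S)) = li (s :: S) := by
  ext n
  cases n with
  | zero => simp [li, liCoeff]
  | succ n =>
    rw [PowerSeries.coeff_succ_X_mul, PowerSeries.coeff_derivative]
    have : (n : ℝ) + 1 ≠ 0 := by positivity
    simp [li, liCoeff, pow_succ]
    field_simp

/-- Formal counterpart of `Li_{1^i} = Li_1^i / i!`; both sides vanish at 0 and, by induction, have
equal derivatives. -/
theorem li_one_mul_li_replicate (i : ℕ) :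
    li [1] * li (List.replicate i 1) = (i + 1 : ℝ⟦X⟧) * li (List.replicate (i + 1) 1) := by
  induction i with
  | zero => simp [li_nil]
  | succ i ih =>
    apply PowerSeries.derivative.ext
    · have h : (d⁄dX ℝ) ((i : ℝ⟦X⟧) + 1 + 1) = 0 := by simp
      push_cast
      rw [Derivation.leibniz, Derivation.leibniz, h]
      simp only [List.replicate_succ, derivative_li_one_cons, smul_eq_mul, li_nil] at ih ⊢
      linear_combination (PowerSeries.mk 1) * ih
    · simp [List.replicate_succ, constantCoeff_li_cons]


/-- The terms of the alternating sum telescope upon differentiation. -/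
theorem derivative_sum_li_mul_li (k n : ℕ) (S : List ℕ+) (hn : n ≤ k) :
    d⁄dX ℝ (∑ i ∈ Finset.range (n + 1), (-1 : ℝ⟦X⟧) ^ i * (li (List.replicate i 1) *
      li (List.replicate (k + 1 - i) 1 ++ S))) =
    (-1) ^ n * (li (List.replicate n 1) * li (List.replicate (k - n) 1 ++ S)) *
      PowerSeries.mk 1 := by
  induction n with
  | zero =>
    simp [li_nil, List.replicate_succ, derivative_li_one_cons]
  | succ n ih =>
    rw [Finset.sum_range_succ, map_add, ih (by omega)]
    obtain ⟨j, rfl⟩ : ∃ j, k = n + 1 + j := ⟨k - (n + 1), by omega⟩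
    have h1 : n + 1 + j - n = j + 1 := by omega
    have h2 : n + 1 + j + 1 - (n + 1) = j + 1 := by omega
    have h3 : n + 1 + j - (n + 1) = j := by omega
    have h4 : d⁄dX ℝ ((-1 : ℝ⟦X⟧) ^ (n + 1)) = 0 := by
      rw [Derivation.leibniz_pow]; simp
    rw [h1, h2, h3, Derivation.leibniz, Derivation.leibniz, h4]
    simp only [List.replicate_succ, List.cons_append, derivative_li_one_cons, smul_eq_mul]
    ring

/-- The identity of formal power series behind the evaluation at `-1`. -/
theorem sum_li_mul_li (k : ℕ) :
    ∑ i ∈ Finset.range (k + 2), (-1 : ℝ⟦X⟧) ^ i * (li (List.replicate i 1) *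
      li (List.replicate (k + 1 - i) 1 ++ 3 :: List.replicate k 1)) =
    C (1 / 2 : ℝ) * ((-1) ^ (k + 1) *
      (li (2 :: List.replicate k 1) * li (2 :: List.replicate k 1))) := by
  apply PowerSeries.derivative.ext
  · apply mul_left_cancel₀ (PowerSeries.X_ne_zero (R := ℝ))
    have h4 : d⁄dX ℝ ((-1 : ℝ⟦X⟧) ^ (k + 1)) = 0 := by
      rw [Derivation.leibniz_pow]; simp
    have h2 : X * d⁄dX ℝ (li (2 :: List.replicate k 1)) = li (1 :: List.replicate k 1) :=
      X_mul_derivative_li_cons 1 _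
    have h3 : X * d⁄dX ℝ (li (3 :: List.replicate k 1)) = li (2 :: List.replicate k 1) :=
      X_mul_derivative_li_cons 2 _
    have h5 : C (1 / 2 : ℝ) * 2 = 1 := by
      rw [← map_ofNat (C (R := ℝ)) 2, ← map_mul]; norm_num
    -- What the first `k + 1` terms leave cancels against half of the product rule for the last
    -- term.
    rw [Finset.sum_range_succ, map_add, derivative_sum_li_mul_li k k _ le_rfl]
    simp only [Derivation.leibniz, h4, PowerSeries.derivative_C, List.replicate_succ,
      derivative_li_one_cons, smul_eq_mul, Nat.sub_self, List.replicate_zero, List.nil_append]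
    linear_combination ((-1) ^ (k + 1) * li (1 :: List.replicate k 1)) * h3 -
      ((-1) ^ (k + 1) * li (2 :: List.replicate k 1)) * h2 -
      ((-1) ^ (k + 1) * li (2 :: List.replicate k 1) *
        (X * d⁄dX ℝ (li (2 :: List.replicate k 1)))) * h5
  · rw [map_sum, Finset.sum_eq_zero]
    · simp [constantCoeff_li_cons]
    · intro i _
      cases i with
      | zero => simp [List.replicate_succ, constantCoeff_li_cons]
      | succ i => simp [List.replicate_succ, constantCoeff_li_cons]


/-! ### Growth of the coefficients -/

theorem liCoeff_nonneg (S : List ℕ+) (n : ℕ) : 0 ≤ liCoeff S n := by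
  induction S generalizing n with
  | nil => simp only [liCoeff]; split_ifs <;> norm_num
  | cons s S ih => exact div_nonneg (Finset.sum_nonneg fun m _ => ih m) (by positivity)

theorem sum_liCoeff_mono (S : List ℕ+) {m n : ℕ} (h : m ≤ n) :
    ∑ i ∈ Finset.range m, liCoeff S i ≤ ∑ i ∈ Finset.range n, liCoeff S i :=
  Finset.sum_le_sum_of_subset_of_nonneg (Finset.range_mono h) fun i _ _ => liCoeff_nonneg S i

/-- Dropping the ordering of the indices and lowering every exponent to 1 bounds the nested sum by a
power of a harmonic number. -/
theorem sum_liCoeff_le (S : List ℕ+) (n : ℕ) :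
    ∑ i ∈ Finset.range n, liCoeff S i ≤ (1 + Real.log n) ^ S.length := by
  induction S with
  | nil => cases n <;> simp [liCoeff]
  | cons s S ih =>
    have hlog : ∑ i ∈ Finset.range n, ((i : ℝ))⁻¹ ≤ 1 + Real.log n := by
      refine le_trans ?_ (harmonic_le_one_add_log n)
      rw [harmonic]
      push_cast
      cases n with
      | zero => simp
      | succ n =>
        rw [Finset.sum_range_succ', Finset.sum_range_succ]
        push_cast
        simp only [inv_zero, add_zero]
        linarith [inv_nonneg.2 (by positivity : (0 : ℝ) ≤ n + 1)]
    have h0 : 0 ≤ ∑ i ∈ Finset.range n, liCoeff S i :=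
      Finset.sum_nonneg fun i _ => liCoeff_nonneg S i
    calc ∑ i ∈ Finset.range n, liCoeff (s :: S) i
        ≤ ∑ i ∈ Finset.range n, (∑ j ∈ Finset.range n, liCoeff S j) * (i : ℝ)⁻¹ := by
          refine Finset.sum_le_sum fun i hi => ?_
          rw [liCoeff, div_eq_mul_inv]
          refine mul_le_mul (sum_liCoeff_mono S (Finset.mem_range.1 hi).le) ?_ (by positivity) h0
          rcases Nat.eq_zero_or_pos i with rfl | hi
          · simp
          · have : (1 : ℝ) ≤ i := by exact_mod_cast hi
            exact inv_anti₀ (by positivity) (le_self_pow₀ this s.pos.ne')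
      _ = (∑ j ∈ Finset.range n, liCoeff S j) * ∑ i ∈ Finset.range n, (i : ℝ)⁻¹ := by
          rw [Finset.mul_sum]
      _ ≤ (1 + Real.log n) ^ S.length * (1 + Real.log n) := by
          refine mul_le_mul ih hlog (Finset.sum_nonneg fun i _ => by positivity) (h0.trans ih)
      _ = _ := by rw [List.length_cons, pow_succ]

/-- `ζ_n(S)` grows more slowly than `√n`. -/
theorem exists_sum_liCoeff_le (S : List ℕ+) :
    ∃ C : ℝ, 0 ≤ C ∧ ∀ n : ℕ, 1 ≤ n →
      ∑ i ∈ Finset.range n, liCoeff S i ≤ C * (n : ℝ) ^ (1 / 2 : ℝ) := by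
  refine ⟨(1 + 2 * S.length) ^ S.length, by positivity, fun n hn => ?_⟩
  have hn' : (1 : ℝ) ≤ n := by exact_mod_cast hn
  refine (sum_liCoeff_le S n).trans ?_
  rcases Nat.eq_zero_or_pos S.length with h | h
  · rw [h]; simpa using Real.one_le_rpow hn' (by norm_num : (0 : ℝ) ≤ 2⁻¹)
  have hl : (0 : ℝ) < S.length := by exact_mod_cast h
  -- The exponent is chosen so that its `S.length`-th power is `√n`.
  have hx : (1 : ℝ) ≤ (n : ℝ) ^ (1 / (2 * S.length : ℝ)) := Real.one_le_rpow hn' (by positivity)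
  have h1 : Real.log n ≤ (n : ℝ) ^ (1 / (2 * S.length : ℝ)) / (1 / (2 * S.length : ℝ)) :=
    Real.log_le_rpow_div (by positivity) (by positivity)
  have h2 : 1 + Real.log n ≤ (1 + 2 * S.length) * (n : ℝ) ^ (1 / (2 * S.length : ℝ)) := by
    rw [div_div_eq_mul_div, div_one] at h1
    linarith
  have h3 : (0 : ℝ) ≤ 1 + Real.log n := by linarith [Real.log_nonneg hn']
  refine (pow_le_pow_left₀ h3 h2 _).trans_eq ?_
  rw [mul_pow, ← Real.rpow_natCast ((n : ℝ) ^ _), ← Real.rpow_mul (by positivity)]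
  congr 2
  field_simp

theorem exists_liCoeff_cons_le (s : ℕ+) (S : List ℕ+) :
    ∃ C : ℝ, 0 ≤ C ∧ ∀ n : ℕ, 1 ≤ n →
      liCoeff (s :: S) n ≤ C * (n : ℝ) ^ (1 / 2 - (s : ℕ) : ℝ) := by
  obtain ⟨C, hC, h⟩ := exists_sum_liCoeff_le S
  refine ⟨C, hC, fun n hn => ?_⟩
  have hn' : (0 : ℝ) < n := by exact_mod_cast hn
  rw [liCoeff, Real.rpow_sub hn', Real.rpow_natCast, ← mul_div_assoc]
  gcongr
  exact h n hn

theorem tendsto_liCoeff_cons (s : ℕ+) (S : List ℕ+) :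
    Tendsto (liCoeff (s :: S)) atTop (𝓝 0) := by
  obtain ⟨C, hC, h⟩ := exists_liCoeff_cons_le s S
  have hs : (1 : ℝ) ≤ (s : ℕ) := by exact_mod_cast s.pos
  have h0 : Tendsto (fun n : ℕ => C * (n : ℝ) ^ (1 / 2 - (s : ℕ) : ℝ)) atTop (𝓝 0) := by
    have := ((tendsto_rpow_neg_atTop (y := (s : ℕ) - 1 / 2) (by linarith)).comp
      (tendsto_natCast_atTop_atTop (R := ℝ))).const_mul C
    simpa [Function.comp_def] using this
  exact squeeze_zero' (.of_forall (liCoeff_nonneg _)) ((eventually_ge_atTop 1).mono h) h0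

theorem summable_liCoeff_cons (s : ℕ+) (S : List ℕ+) (hs : 2 ≤ (s : ℕ)) :
    Summable (liCoeff (s :: S)) := by
  obtain ⟨C, hC, h⟩ := exists_liCoeff_cons_le s S
  have hs' : (2 : ℝ) ≤ (s : ℕ) := by exact_mod_cast hs
  refine Summable.of_norm_bounded_eventually_nat
    ((Real.summable_nat_rpow (p := 1 / 2 - (s : ℕ)).2 (by linarith)).mul_left C) ?_
  filter_upwards [eventually_ge_atTop 1] with n hn
  rw [Real.norm_of_nonneg (liCoeff_nonneg _ _)]
  exact h n hn

/-- If `c_n = (1/n) ∑_{m<n} b_m`, then `c_n - c_{n+1} = (c_n - b_n)/(n+1)`. Both `c_n` and `b_n` are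
`O(n^{-1/2})`, so the difference is `O(n^{-3/2})`. -/
theorem summable_liCoeff_sub (s : ℕ+) (S : List ℕ+) :
    Summable fun n => liCoeff (1 :: s :: S) n - liCoeff (1 :: s :: S) (n + 1) := by
  obtain ⟨C, hC, h⟩ := exists_liCoeff_cons_le 1 (s :: S)
  obtain ⟨D, hD, h'⟩ := exists_liCoeff_cons_le s S
  have hs : (1 : ℝ) ≤ (s : ℕ) := by exact_mod_cast s.pos
  refine Summable.of_norm_bounded_eventually_nat
    ((Real.summable_nat_rpow (p := -(3 / 2))).2 (by norm_num) |>.mul_left (C + D)) ?_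
  filter_upwards [eventually_ge_atTop 1] with n hn
  have hn' : (1 : ℝ) ≤ n := by exact_mod_cast hn
  have e : liCoeff (1 :: s :: S) n - liCoeff (1 :: s :: S) (n + 1) =
      liCoeff (1 :: s :: S) n / (n + 1) - liCoeff (s :: S) n / (n + 1) := by
    have u (m : ℕ) : liCoeff (1 :: s :: S) m =
        (∑ i ∈ Finset.range m, liCoeff (s :: S) i) / m := by
      simp only [liCoeff, PNat.one_coe, pow_one]
    rw [u, u, Finset.sum_range_succ]
    push_cast
    field_simp
    ring
  have hp : (n : ℝ) ^ (-(3 / 2) : ℝ) = (n : ℝ) ^ (-(1 / 2) : ℝ) / n := by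
    rw [← Real.rpow_sub_one (by positivity)]; norm_num
  have a1 : liCoeff (1 :: s :: S) n ≤ C * (n : ℝ) ^ (-(1 / 2) : ℝ) := by
    refine (h n hn).trans_eq ?_
    norm_num
  have a2 : liCoeff (s :: S) n ≤ D * (n : ℝ) ^ (-(1 / 2) : ℝ) := by
    refine (h' n hn).trans ?_
    gcongr
    linarith
  have b1 := liCoeff_nonneg (1 :: s :: S) n
  have b2 := liCoeff_nonneg (s :: S) n
  rw [e, ← sub_div, norm_div, Real.norm_eq_abs, Real.norm_of_nonneg (by positivity), hp,
    ← mul_div_assoc]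
  have : |liCoeff (1 :: s :: S) n - liCoeff (s :: S) n| ≤ (C + D) * (n : ℝ) ^ (-(1 / 2) : ℝ) := by
    rw [add_mul, abs_le]; constructor <;> linarith
  gcongr
  linarith

/-! ### Convergence at `-1` and Abel limits -/

/-- An alternating series whose terms tend to zero with bounded variation converges. -/
theorem exists_tendsto_sum_neg_one_pow_mul {c : ℕ → ℝ} (hc : Tendsto c atTop (𝓝 0))
    (hs : Summable fun n => c n - c (n + 1)) :
    ∃ l, Tendsto (fun n => ∑ i ∈ Finset.range n, (-1 : ℝ) ^ i * c i) atTop (𝓝 l) := by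
  have hs' : Summable fun n => (-1 : ℝ) ^ n * (c n - c (n + 1)) := by
    refine Summable.of_norm ?_
    simpa using hs.norm
  -- Summation by parts: averaging the sum with its shift by one pairs neighbouring terms.
  have e (n : ℕ) : ∑ i ∈ Finset.range n, (-1 : ℝ) ^ i * c i =
      (∑ i ∈ Finset.range n, (-1 : ℝ) ^ i * (c i - c (i + 1)) + c 0 - (-1) ^ n * c n) / 2 := by
    induction n with
    | zero => simp
    | succ n ih => rw [Finset.sum_range_succ, Finset.sum_range_succ, ih]; ring
  have h0 : Tendsto (fun n => (-1 : ℝ) ^ n * c n) atTop (𝓝 0) := by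
    rw [tendsto_zero_iff_norm_tendsto_zero] at hc ⊢
    simpa using hc
  simp_rw [e]
  exact ⟨_, ((hs'.hasSum.tendsto_sum_nat.add_const _).sub h0).div_const 2⟩

theorem exists_tendsto_sum_liCoeff_one_cons (s : ℕ+) (S : List ℕ+) :
    ∃ l, Tendsto (fun n => ∑ i ∈ Finset.range n, (-1 : ℝ) ^ i * liCoeff (1 :: s :: S) i)
      atTop (𝓝 l) :=
  exists_tendsto_sum_neg_one_pow_mul (tendsto_liCoeff_cons 1 _) (summable_liCoeff_sub s S)

theorem exists_tendsto_sum_liCoeff_cons (s : ℕ+) (S : List ℕ+) (hs : 2 ≤ (s : ℕ)) :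
    ∃ l, Tendsto (fun n => ∑ i ∈ Finset.range n, (-1 : ℝ) ^ i * liCoeff (s :: S) i)
      atTop (𝓝 l) := by
  have : Summable fun i => (-1 : ℝ) ^ i * liCoeff (s :: S) i := by
    refine Summable.of_norm ?_
    simpa using (summable_liCoeff_cons s S hs).norm
  exact ⟨_, this.hasSum.tendsto_sum_nat⟩

/-- The value of `Li_S` at `-x`. -/
noncomputable def liNeg (S : List ℕ+) (x : ℝ) : ℝ := ∑' n, (-1) ^ n * liCoeff S n * x ^ n

theorem converges_and_tendsto_liNeg (s : ℕ+) (S : List ℕ+)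
    (h : ∃ l, Tendsto (fun n => ∑ i ∈ Finset.range n, (-1 : ℝ) ^ i * liCoeff (s :: S) i)
      atTop (𝓝 l)) :
    Converges (bar s :: S.map plain) ∧
      Tendsto (liNeg (s :: S)) (𝓝[<] 1) (𝓝 (zeta (bar s :: S.map plain))) := by
  obtain ⟨l, hl⟩ := h
  have hl' : Tendsto (fun n => multipleHarmonic n (bar s :: S.map plain)) atTop (𝓝 l) := by
    simp_rw [multipleHarmonic_bar_cons]
    exact hl.comp (tendsto_add_atTop_nat 1)
  refine ⟨⟨l, hl'⟩, ?_⟩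
  rw [zeta, hl'.limUnder_eq]
  exact Real.tendsto_tsum_powerSeries_nhdsWithin_lt hl

/-! ### Evaluation at `-x` for `|x| < 1` -/

theorem summable_norm_liCoeff_mul_pow (S : List ℕ+) {x : ℝ} (hx : |x| < 1) :
    Summable fun n => ‖liCoeff S n * x ^ n‖ := by
  cases S with
  | nil =>
    refine summable_of_ne_finset_zero (s := {0}) fun n hn => ?_
    simp [liCoeff, Finset.notMem_singleton.1 hn]
  | cons s S =>
    have hg : Summable fun n => |x| ^ n := summable_geometric_of_lt_one (abs_nonneg x) hx
    refine Summable.of_norm_bounded_eventually_nat hg ?_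
    filter_upwards [(tendsto_liCoeff_cons s S).eventually (gt_mem_nhds one_pos)] with n hn
    rw [norm_norm, norm_mul, norm_pow, Real.norm_of_nonneg (liCoeff_nonneg _ _), Real.norm_eq_abs]
    exact mul_le_of_le_one_left (by positivity) hn.le

theorem liNeg_eq (S : List ℕ+) (x : ℝ) : liNeg S x = ∑' n, liCoeff S n * (-x) ^ n := by
  unfold liNeg
  congr with n
  rw [neg_pow x]
  ring

theorem hasSum_li (S : List ℕ+) {x : ℝ} (hx : |x| < 1) :
    HasSum (fun n => coeff n (li S) * (-x) ^ n) (liNeg S x) := by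
  rw [liNeg_eq]
  simp only [li, coeff_mk]
  exact (summable_norm_liCoeff_mul_pow S (by rwa [abs_neg])).of_norm.hasSum

theorem hasSum_li_mul_li (S T : List ℕ+) {x : ℝ} (hx : |x| < 1) :
    HasSum (fun n => coeff n (li S * li T) * (-x) ^ n) (liNeg S x * liNeg T x) := by
  have hS := summable_norm_liCoeff_mul_pow S (x := -x) (by rwa [abs_neg])
  have hT := summable_norm_liCoeff_mul_pow T (x := -x) (by rwa [abs_neg])
  have e : (fun n => coeff n (li S * li T) * (-x) ^ n) = fun n =>
      ∑ kl ∈ Finset.HasAntidiagonal.antidiagonal n,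
        (liCoeff S kl.1 * (-x) ^ kl.1) * (liCoeff T kl.2 * (-x) ^ kl.2) := by
    ext n
    rw [PowerSeries.coeff_mul, Finset.sum_mul]
    refine Finset.sum_congr rfl fun kl hkl => ?_
    rw [← Finset.HasAntidiagonal.mem_antidiagonal.1 hkl, pow_add]
    simp only [li, coeff_mk]
    ring
  rw [e, liNeg_eq, liNeg_eq, tsum_mul_tsum_eq_tsum_sum_antidiagonal_of_summable_norm hS hT]
  exact (summable_norm_sum_mul_antidiagonal_of_summable_norm hS hT).of_norm.hasSum

theorem liNeg_nil (x : ℝ) : liNeg [] x = 1 := by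
  rw [liNeg, tsum_eq_single 0]
  · simp [liCoeff]
  · intro n hn; simp [liCoeff, hn]

theorem liNeg_one {x : ℝ} (hx : |x| < 1) : liNeg [1] x = -Real.log (1 + x) := by
  have h := Real.hasSum_pow_div_log_of_abs_lt_one (x := -x) (by rwa [abs_neg])
  have h' := hasSum_li [1] hx
  -- The logarithm series starts at exponent 1, so the zero constant term is split off.
  rw [← hasSum_nat_add_iff' 1] at h'
  simp only [sub_neg_eq_add] at h
  have := h'.unique (h.congr_fun ?_)
  · simpa [li, liCoeff] using this
  · intro n
    simp [li, liCoeff]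
    ring

theorem liNeg_replicate_one (i : ℕ) {x : ℝ} (hx : |x| < 1) :
    liNeg (List.replicate i 1) x = (-Real.log (1 + x)) ^ i / i.factorial := by
  induction i with
  | zero => simp [liNeg_nil]
  | succ i ih =>
    have h := hasSum_li_mul_li [1] (List.replicate i 1) hx
    rw [li_one_mul_li_replicate] at h
    have e : (i + 1 : ℝ⟦X⟧) = C (i + 1 : ℝ) := by simp
    simp_rw [e, coeff_C_mul, mul_assoc] at h
    have h2 := h.unique ((hasSum_li (List.replicate (i + 1) 1) hx).mul_left (i + 1 : ℝ))
    rw [ih, liNeg_one hx] at h2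
    rw [Nat.factorial_succ]
    push_cast
    have : (i.factorial : ℝ) ≠ 0 := by positivity
    rw [pow_succ, eq_div_iff (by positivity), mul_comm, mul_right_comm, ← h2]
    field_simp

/-- The sign `(-1)^i` of the formal identity absorbs that of `(-log(1+x))^i`. -/
theorem sum_liNeg_mul_liNeg (k : ℕ) {x : ℝ} (hx : |x| < 1) :
    ∑ i ∈ Finset.range (k + 2), Real.log (1 + x) ^ i / i.factorial *
      liNeg (List.replicate (k + 1 - i) 1 ++ 3 :: List.replicate k 1) x =
    (-1) ^ (k + 1) * (1 / 2) * liNeg (2 :: List.replicate k 1) x ^ 2 := by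
  have h := hasSum_sum (s := Finset.range (k + 2)) fun i _ =>
    (hasSum_li_mul_li (List.replicate i 1)
      (List.replicate (k + 1 - i) 1 ++ 3 :: List.replicate k 1) hx).mul_left ((-1 : ℝ) ^ i)
  have h' := (hasSum_li_mul_li (2 :: List.replicate k 1) (2 :: List.replicate k 1) hx).mul_left
    ((-1 : ℝ) ^ (k + 1) * (1 / 2))
  have e (i : ℕ) : (-1 : ℝ⟦X⟧) ^ i = C ((-1 : ℝ) ^ i) := by simp
  have e' (n : ℕ) := congrArg (fun f => coeff n f * (-x) ^ n) (sum_li_mul_li k)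
  simp only [e, map_sum, coeff_C_mul, Finset.sum_mul] at e'
  have key := h.unique (h'.congr_fun fun n => ?_)
  · rw [pow_two, ← key]
    refine Finset.sum_congr rfl fun i _ => ?_
    rw [liNeg_replicate_one i hx, neg_pow (Real.log _)]
    rw [← mul_assoc, ← mul_div_assoc, ← mul_assoc, ← mul_pow]
    norm_num
  · simp only [← mul_assoc] at e' ⊢
    rw [e' n]
    ring

/-! ### Passage to the limit `x → 1⁻` -/

theorem bar_cons_ones_append (s : ℕ+) (r k : ℕ) :
    bar s :: ones r ++ plain 3 :: ones k =
      bar s :: (List.replicate r (1 : ℕ+) ++ 3 :: List.replicate k 1).map plain := by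
  simp [ones]

theorem bar_cons_ones (s : ℕ+) (k : ℕ) :
    bar s :: ones k = bar s :: (List.replicate k (1 : ℕ+)).map plain := by
  simp [ones]

theorem converges_bar_one (r k : ℕ) :
    Converges (bar 1 :: ones r ++ plain 3 :: ones k) ∧
      Tendsto (liNeg (List.replicate (r + 1) 1 ++ 3 :: List.replicate k 1)) (𝓝[<] 1)
        (𝓝 (zeta (bar 1 :: ones r ++ plain 3 :: ones k))) := by
  rw [bar_cons_ones_append, List.replicate_succ, List.cons_append]
  refine converges_and_tendsto_liNeg _ _ ?_
  -- The argument after the leading 1 is 3 when `r = 0` and 1 otherwise.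
  cases r with
  | zero => exact exists_tendsto_sum_liCoeff_one_cons _ _
  | succ r => exact exists_tendsto_sum_liCoeff_one_cons _ _

theorem converges_bar (s : ℕ+) (hs : 2 ≤ (s : ℕ)) (k : ℕ) :
    Converges (bar s :: ones k) ∧
      Tendsto (liNeg (s :: List.replicate k 1)) (𝓝[<] 1) (𝓝 (zeta (bar s :: ones k))) := by
  rw [bar_cons_ones]
  exact converges_and_tendsto_liNeg _ _ (exists_tendsto_sum_liCoeff_cons _ _ hs)

/-- The term `i = k + 1` stands apart: no leading ones remain, so the bar falls on the 3. -/
theorem sum_zeta_bar_one (k : ℕ) :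
    ∑ i ∈ Finset.range (k + 1), Real.log 2 ^ i / i.factorial *
      zeta (bar 1 :: ones (k - i) ++ plain 3 :: ones k) +
      Real.log 2 ^ (k + 1) / (k + 1).factorial * zeta (bar 3 :: ones k) =
    (-1) ^ (k + 1) * (1 / 2) * zeta (bar 2 :: ones k) ^ 2 := by
  have hlog : Tendsto (fun x : ℝ => Real.log (1 + x)) (𝓝[<] 1) (𝓝 (Real.log 2)) := by
    have : ContinuousAt (fun x : ℝ => Real.log (1 + x)) 1 :=
      ContinuousAt.log (by fun_prop) (by norm_num)
    have h := this.tendsto.mono_left (nhdsWithin_le_nhds (s := Set.Iio 1))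
    rwa [one_add_one_eq_two] at h
  have hl : Tendsto (fun x => ∑ i ∈ Finset.range (k + 1), Real.log (1 + x) ^ i / i.factorial *
      liNeg (List.replicate (k - i + 1) 1 ++ 3 :: List.replicate k 1) x +
      Real.log (1 + x) ^ (k + 1) / (k + 1).factorial * liNeg (3 :: List.replicate k 1) x)
      (𝓝[<] 1) (𝓝 (∑ i ∈ Finset.range (k + 1), Real.log 2 ^ i / i.factorial *
      zeta (bar 1 :: ones (k - i) ++ plain 3 :: ones k) +
      Real.log 2 ^ (k + 1) / (k + 1).factorial * zeta (bar 3 :: ones k))) :=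
    (tendsto_finsetSum _ fun i _ =>
      ((hlog.pow i).div_const _).mul (converges_bar_one (k - i) k).2).add
      (((hlog.pow (k + 1)).div_const _).mul (converges_bar 3 (by decide) k).2)
  have hr := ((converges_bar 2 (by decide) k).2.pow 2).const_mul ((-1 : ℝ) ^ (k + 1) * (1 / 2))
  refine tendsto_nhds_unique_of_eventuallyEq hl hr ?_
  filter_upwards [Ioo_mem_nhdsLT (show (0 : ℝ) < 1 by norm_num)] with x hx
  rw [← sum_liNeg_mul_liNeg k (abs_lt.2 ⟨by linarith [hx.1], hx.2⟩), Finset.sum_range_succ _ (k + 1)]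
  congr 1
  · refine Finset.sum_congr rfl fun i hi => ?_
    rw [Nat.sub_add_comm (Nat.lt_succ_iff.1 (Finset.mem_range.1 hi))]
  · simp

end AltMZV

theorem corollary5p1 (k : ℕ) (hk : 1 ≤ k) :
    ((∀ r : ℕ, r < k → AltMZV.Converges
        (AltMZV.bar 1 :: AltMZV.ones r ++ AltMZV.plain 3 :: AltMZV.ones (k - 1))) ∧
      AltMZV.Converges (AltMZV.bar 3 :: AltMZV.ones (k - 1)) ∧
      AltMZV.Converges (AltMZV.bar 2 :: AltMZV.ones (k - 1))) ∧
    AltMZV.zeta (AltMZV.bar 1 :: AltMZV.ones (k - 1) ++ AltMZV.plain 3 :: AltMZV.ones (k - 1)) =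
      -(∑ i ∈ Finset.Icc 1 (k - 1), Real.log 2 ^ i / (i.factorial : ℝ) *
          AltMZV.zeta (AltMZV.bar 1 :: AltMZV.ones (k - i - 1) ++
            AltMZV.plain 3 :: AltMZV.ones (k - 1)))
      - Real.log 2 ^ k / (k.factorial : ℝ) * AltMZV.zeta (AltMZV.bar 3 :: AltMZV.ones (k - 1))
      + (-1 : ℝ) ^ k * (1 / 2) * AltMZV.zeta (AltMZV.bar 2 :: AltMZV.ones (k - 1)) ^ 2 := by
  obtain ⟨k, rfl⟩ : ∃ m, k = m + 1 := ⟨k - 1, by omega⟩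
  simp only [Nat.add_sub_cancel]
  refine ⟨⟨fun r _ => (AltMZV.converges_bar_one r k).1, (AltMZV.converges_bar 3 (by decide) k).1,
    (AltMZV.converges_bar 2 (by decide) k).1⟩, ?_⟩
  have h := AltMZV.sum_zeta_bar_one k
  -- The term `i = 0` is the value to be isolated.
  rw [Finset.sum_range_eq_add_Ico _ k.succ_pos] at h
  have e : Finset.Icc 1 k = Finset.Ico 1 (k + 1) := by ext; simp
  have e' : ∀ i, k + 1 - i - 1 = k - i := fun i => by omega
  simp only [e, e']
  simp only [pow_zero, Nat.factorial_zero, Nat.cast_one, div_one, one_mul, Nat.sub_zero,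
    Nat.succ_eq_add_one] at h
  linarith
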